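/- Let $d\ge 1$ and let $(Y_n)_{n\ge 1}$ be i.i.d. random vectors $Y_n=(Y_n^1,\dots,Y_n^d)$ with values in $\mathbb{Z}^d$ (the coordinates of $Y_n$ may be dependent), such that $\mathbb{P}(Y_1^i>0)>0$ for each $i$. For a starting point $w\in\mathbb{N}_0^d$ let $W_0=w$ and $W_n^i=\max\{W_{n-1}^i-Y_n^i,0\}$ for $n\ge1$, $1\le i\le d$. A set of states of a Markov chain is called an essential class if it is non-empty, irreducible and absorbing; the chain is positive recurrent in an essential class if the first return time to each state of the class, for the chain started at that state, has finite expectation. Suppose that each coordinate Lindley process $(W_n^i)_{n\ge 0}$, a Markov chain on $\mathbb{N}_0$, is positive recurrent (in its essential class). Put $F_n(x)=\max\{x-Y_n,0\}$ (coordinatewise) for $x\in\mathbb{R}^d$. Then there is a random variable $U$ with values in $\mathbb{N}_0^d$ such that, for every $x\in\mathbb{R}^d$, $$F_1\circ\cdots\circ F_n(x)\longrightarrow U\quad\text{a.s. as } n\to\infty ,$$ and the distribution of $U$ is the unique invariant probability measure on $\mathbb{N}_0^d$ of the $d$-dimensional Lindley process $(W_n^1,\dots,W_n^d)$. Moreover,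 this process has exactly one essential class, and it is positive recurrent in this class. -/

import Mathlib

open MeasureTheory ProbabilityTheory Filter Topology
open scoped ENNReal

noncomputable section

/-! ### Markov chains given as families of processes

A chain on a countable state space `X` is given by its family of trajectories: `W x n ω` is the
position at time `n` of the chain started at `x`. -/

section Chain

/-- `y` is reached from `x` with positive probability. -/
def Accessible {Ω X : Type*} [MeasurableSpace Ω] (P : Measure Ω) (W : X → ℕ → Ω → X)
    (x y : X) : Prop :=
  ∃ n : ℕ, 0 < P {ω | W x n ω = y}

/-- An essential class: a nonempty, irreducible and absorbing set of states. -/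
structure IsEssentialClass {Ω X : Type*} [MeasurableSpace Ω] (P : Measure Ω)
    (W : X → ℕ → Ω → X) (C : Set X) : Prop where
  nonempty : C.Nonempty
  irreducible : ∀ x ∈ C, ∀ y ∈ C, Accessible P W x y
  absorbing : ∀ x ∈ C, ∀ n : ℕ, ∀ᵐ ω ∂P, W x n ω ∈ C

/-- The first return time `inf {n ≥ 1 : W_n = x}` of the chain started at `x`
(the infimum of the empty set is `⊤`). -/
def returnTime {Ω X : Type*} (W : X → ℕ → Ω → X) (x : X) (ω : Ω) : ℕ∞ :=
  ⨅ (n : ℕ) (_ : 1 ≤ n ∧ W x n ω = x), (n : ℕ∞)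

/-- A state is positive recurrent if its return time has finite expectation. -/
def IsPositiveRecurrentState {Ω X : Type*} [MeasurableSpace Ω] (P : Measure Ω)
    (W : X → ℕ → Ω → X) (x : X) : Prop :=
  ∫⁻ ω, (returnTime W x ω : ℝ≥0∞) ∂P < ⊤

/-- `C` is an essential class all of whose states are positive recurrent. -/
def IsPositiveRecurrentIn {Ω X : Type*} [MeasurableSpace Ω] (P : Measure Ω)
    (W : X → ℕ → Ω → X) (C : Set X) : Prop :=
  IsEssentialClass P W C ∧ ∀ x ∈ C, IsPositiveRecurrentState P W x

end Chain

/-! ### Lindley processes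

Sequences are indexed from `0`, so `y n` is the increment used in step `n + 1`. -/

section Lindley

/-- The Lindley recursion on the nonnegative integers: `W_0 = w`,
`W_{n+1} = max {W_n - y_{n+1}, 0}`; `Int.toNat` is `z ↦ max {z, 0}`. -/
def lindley (y : ℕ → ℤ) (w : ℕ) : ℕ → ℕ
  | 0 => w
  | n + 1 => ((lindley y w n : ℤ) - y n).toNat

/-- The `i`-th coordinate Lindley process driven by the random vectors `Y`. -/
def coordLindley {Ω : Type*} {d : ℕ} (Y : ℕ → Ω → Fin d → ℤ) (i : Fin d) :
    ℕ → ℕ → Ω → ℕ :=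
  fun w n ω => lindley (fun k => Y k ω i) w n

/-- The `d`-dimensional Lindley process `(W^1, …, W^d)` driven by the random vectors `Y`. -/
def multiLindley {Ω : Type*} {d : ℕ} (Y : ℕ → Ω → Fin d → ℤ) :
    (Fin d → ℕ) → ℕ → Ω → (Fin d → ℕ) :=
  fun w n ω i => coordLindley Y i (w i) n ω

/-- The one-step transition kernel of the `d`-dimensional Lindley process:
`w` is sent to the law of `W_1` given `W_0 = w`. -/
def lindleyKernel {Ω : Type*} [MeasurableSpace Ω] {d : ℕ} (P : Measure Ω)
    (Y : ℕ → Ω → Fin d → ℤ) : Kernel (Fin d → ℕ) (Fin d → ℕ) :=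
  Kernel.ofFunOfCountable fun w => P.map (multiLindley Y w 1)

/-- The map `x ↦ max {x - y, 0}` on `ℝ^d`, taken coordinatewise. -/
def lindleyMap {d : ℕ} (y : Fin d → ℤ) (x : Fin d → ℝ) : Fin d → ℝ :=
  fun i => max (x i - (y i : ℝ)) 0

/-- The backward iteration `F_1 ∘ ⋯ ∘ F_n`, with `F n` in the role of `F_{n+1}`. -/
def backward {X : Type*} (F : ℕ → X → X) : ℕ → X → X
  | 0 => id
  | n + 1 => backward F n ∘ F n

end Lindley

end

/-! ### Independent identically distributed sequences -/

section IID

/-! Write `S_n` for the partial sums of one coordinate. Unfolding the backward iteration gives `F_1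
∘ ⋯ ∘ F_{n+1}(x) = max (M_n, x - S_{n+1})` with `M_n = max (0, -S_1, …, -S_n)`
(`backward_lindleyStep_succ`, `backward_real_succ`). If `S_n → ∞`, this is eventually constant,
equal to `sup M_n`, for every start `x`. Being an almost sure statement about each coordinate, it is
insensitive to dependence between coordinates.

Divergence of `S_n` comes from recurrence, without any moment assumption. By reversal, the chain
started at `0` is at `0` at time `n` with probability `P(M_n = 0)`, which decreases to `P(S_m ≥ 0
for all m)`. Were this limit zero, the last-visit identity `sum_last_visit` would contradict the
finite mean return time to `0`. So the walk stays nonnegative with positive probability;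
Kolmogorov's law makes it bounded below almost surely, and a maximum principle excludes a finite
lower limit (`measure_liminfEq_eq_zero`).

The rest holds for any countable chain whose backward iteration is almost surely eventually constant
with a limit independent of the start. Forward and backward laws agree at fixed times, so transition
probabilities converge to the law of the limit `U`. This gives uniqueness of the invariant law,
accessibility of every atom of `U` from everywhere, and, through the last-visit identity again,
positive recurrence of those atoms. Invariance follows from the fixed point equation relating `U` to
its shifted copy. -/

theorem measurable_shift_tail {Ω E : Type*} [MeasurableSpace E] (Z : ℕ → Ω → E) (m : ℕ) :
    Measurable[⨆ k ∈ Set.Ici m, MeasurableSpace.comap (Z k) inferInstance]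
      (fun ω (k : ℕ) => Z (k + m) ω) := by
  refine @measurable_pi_lambda _ _ _ (_) _ _ fun k => ?_
  refine Measurable.mono (comap_measurable (Z (k + m))) ?_ le_rfl
  exact le_iSup₂_of_le (k + m) (by simp) le_rfl

variable {Ω E : Type*} [MeasurableSpace Ω] [MeasurableSpace E] {P : Measure Ω}
  [IsProbabilityMeasure P] {Z : ℕ → Ω → E}

/-- Reindexing an i.i.d. sequence injectively does not change its law. -/
theorem iid_map_reindex (hm : ∀ n, Measurable (Z n)) (hi : iIndepFun Z P)
    (hd : ∀ n, IdentDistrib (Z n) (Z 0) P P) {σ : ℕ → ℕ} (hσ : σ.Injective) :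
    P.map (fun ω k => Z (σ k) ω) = P.map (fun ω k => Z k ω) := by
  rw [(iIndepFun_iff_map_fun_eq_infinitePi_map (fun k => hm (σ k))).1 (hi.precomp hσ),
    (iIndepFun_iff_map_fun_eq_infinitePi_map hm).1 hi]
  congr 1
  funext k
  rw [(hd (σ k)).map_eq, (hd k).map_eq]

theorem iid_measure_reindex (hm : ∀ n, Measurable (Z n)) (hi : iIndepFun Z P)
    (hd : ∀ n, IdentDistrib (Z n) (Z 0) P P) {σ : ℕ → ℕ} (hσ : σ.Injective)
    {T : Set (ℕ → E)} (hT : MeasurableSet T) :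
    P {ω | (fun k => Z (σ k) ω) ∈ T} = P {ω | (fun k => Z k ω) ∈ T} := by
  have h := congrArg (fun μ => μ T) (iid_map_reindex hm hi hd hσ)
  rwa [Measure.map_apply (measurable_pi_lambda _ fun k => hm (σ k)) hT,
    Measure.map_apply (measurable_pi_lambda _ hm) hT] at h

/-- The past of an i.i.d. sequence is independent of its shift, which has the original law. -/
theorem iid_measure_inter_shift (hm : ∀ n, Measurable (Z n)) (hi : iIndepFun Z P)
    (hd : ∀ n, IdentDistrib (Z n) (Z 0) P P) (m : ℕ) {s : Set Ω}
    (hs : MeasurableSet[⨆ k ∈ Set.Iio m, MeasurableSpace.comap (Z k) inferInstance] s)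
    {T : Set (ℕ → E)} (hT : MeasurableSet T) :
    P (s ∩ {ω | (fun k => Z (k + m) ω) ∈ T}) = P s * P {ω | (fun k => Z k ω) ∈ T} := by
  have hind := indep_iSup_of_disjoint (fun k => (hm k).comap_le) hi.iIndep
    (S := Set.Iio m) (T := Set.Ici m) (Set.Iio_disjoint_Ici le_rfl)
  rw [Indep_iff] at hind
  rw [← iid_measure_reindex hm hi hd (σ := fun k => k + m) (add_left_injective m) hT]
  exact hind s _ hs (measurable_shift_tail Z m hT)

end IID

/-- Kolmogorov's law for events that do not change under any shift of the sequence. -/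
theorem iid_zero_or_one_of_shift_invariant {Ω E : Type*} [MeasurableSpace Ω]
    [MeasurableSpace E] {P : Measure Ω} {Z : ℕ → Ω → E} (hm : ∀ n, Measurable (Z n))
    (hi : iIndepFun Z P) {T : Set (ℕ → E)} (hT : MeasurableSet T)
    (hinv : ∀ (y : ℕ → E) (m : ℕ), (fun k => y (k + m)) ∈ T ↔ y ∈ T) :
    P {ω | (fun k => Z k ω) ∈ T} = 0 ∨ P {ω | (fun k => Z k ω) ∈ T} = 1 := by
  refine measure_zero_or_one_of_measurableSet_limsup_atTop (fun k => (hm k).comap_le)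
    hi.iIndep ?_
  rw [limsup_eq_iInf_iSup_of_nat, MeasurableSpace.measurableSet_iInf]
  intro m
  have := measurable_shift_tail Z m hT
  convert! this using 1
  ext ω
  exact (hinv (fun k => Z k ω) m).symm

/-! ### Chains driven by an i.i.d. sequence -/

/-- The trajectory started at `x` of the recursion `x ↦ G x (y n)`. -/
def trajectory {X E : Type*} (G : X → E → X) (y : ℕ → E) (x : X) : ℕ → X
  | 0 => x
  | n + 1 => G (trajectory G y x n) (y n)

section Trajectory

variable {X E : Type*} {G : X → E → X}

theorem trajectory_add (y : ℕ → E) (x : X) (m n : ℕ) :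
    trajectory G y x (m + n) = trajectory G (fun k => y (k + m)) (trajectory G y x m) n := by
  induction n with
  | zero => rfl
  | succ n ih => rw [← add_assoc, trajectory, trajectory, ih, add_comm n m]

theorem trajectory_congr {y y' : ℕ → E} (x : X) {n : ℕ} (h : ∀ k < n, y k = y' k) :
    trajectory G y x n = trajectory G y' x n := by
  induction n with
  | zero => rfl
  | succ n ih =>
    rw [trajectory, trajectory, ih fun k hk => h k (hk.trans n.lt_succ_self), h n n.lt_succ_self]

/-- Running the recursion forward along the reversed sequence is the backward iteration. -/
theorem trajectory_reverse (n : ℕ) (y : ℕ → E) (x : X) :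
    trajectory G (fun k => if k < n then y (n - 1 - k) else y k) x n
      = backward (fun k x => G x (y k)) n x := by
  induction n generalizing x with
  | zero => rfl
  | succ n ih =>
    -- The reversed block begins with `y n`, the innermost map of the backward iteration; what
    -- remains is the reversal of the first `n` terms.
    rw [backward, Function.comp, ← ih, add_comm n 1, trajectory_add]
    have h1 : trajectory G (fun k => if k < 1 + n then y (1 + n - 1 - k) else y k) x 1
        = G x (y n) := by
      simp [trajectory]
    rw [h1]
    refine trajectory_congr _ fun k hk => ?_
    rw [if_pos (by omega), if_pos hk]
    congr 1
    omega

theorem reverse_injective (n : ℕ) :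
    Function.Injective (fun k => if k < n then n - 1 - k else k) := by
  intro a b h
  simp only at h
  split_ifs at h <;> omega

/-- Peels off the outermost map, whereas the definition peels off the innermost one; this yields the
fixed point equation of the backward limit. -/
theorem backward_succ_shift {X : Type*} (F : ℕ → X → X) (n : ℕ) (x : X) :
    backward F (n + 1) x = F 0 (backward (fun k => F (k + 1)) n x) := by
  induction n generalizing x with
  | zero => rfl
  | succ n ih => rw [backward, Function.comp, ih]; rfl

variable [MeasurableSpace X] [MeasurableSpace E]

theorem measurable_trajectory (hG : Measurable (Function.uncurry G)) (x : X) (n : ℕ) :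
    Measurable (fun y : ℕ → E => trajectory G y x n) := by
  induction n with
  | zero => exact measurable_const
  | succ n ih => exact hG.comp (ih.prodMk (measurable_pi_apply n))

theorem measurable_backward (hG : Measurable (Function.uncurry G)) (x : X) (n : ℕ) :
    Measurable (fun y : ℕ → E => backward (fun k x => G x (y k)) n x) := by
  simp_rw [← trajectory_reverse]
  refine (measurable_trajectory hG x n).comp (measurable_pi_lambda _ fun k => ?_)
  split_ifs <;> exact measurable_pi_apply _

theorem measurable_trajectory_past {Ω : Type*} {Z : ℕ → Ω → E}
    (hG : Measurable (Function.uncurry G)) (x : X) (n : ℕ) :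
    Measurable[⨆ k ∈ Set.Iio n, MeasurableSpace.comap (Z k) inferInstance]
      (fun ω => trajectory G (fun k => Z k ω) x n) := by
  induction n with
  | zero => exact @measurable_const _ _ _ (_) _
  | succ n ih =>
    refine hG.comp (@Measurable.prodMk _ _ _ _ _ (_) _ _ ?_ ?_)
    · refine ih.mono ?_ le_rfl
      exact iSup₂_mono' fun k hk => ⟨k, lt_trans hk n.lt_succ_self, le_rfl⟩
    · refine Measurable.mono (comap_measurable (Z n)) ?_ le_rfl
      exact le_iSup₂_of_le n (by simp) le_rfl

variable {Ω : Type*} [MeasurableSpace Ω] {P : Measure Ω} [IsProbabilityMeasure P]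
  {Z : ℕ → Ω → E}

/-- The Markov property at a fixed time. -/
theorem measure_trajectory_inter_shift [MeasurableSingletonClass X]
    (hG : Measurable (Function.uncurry G))
    (hm : ∀ n, Measurable (Z n)) (hi : iIndepFun Z P)
    (hd : ∀ n, IdentDistrib (Z n) (Z 0) P P) (x z : X) (m : ℕ)
    {T : Set (ℕ → E)} (hT : MeasurableSet T) :
    P ({ω | trajectory G (fun k => Z k ω) x m = z} ∩ {ω | (fun k => Z (k + m) ω) ∈ T})
      = P {ω | trajectory G (fun k => Z k ω) x m = z} * P {ω | (fun k => Z k ω) ∈ T} :=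
  iid_measure_inter_shift hm hi hd m
    (measurable_trajectory_past hG x m (measurableSet_singleton z)) hT

/-- Forward and backward iteration have the same law at each fixed time. -/
theorem measure_trajectory_eq_backward [MeasurableSingletonClass X]
    (hG : Measurable (Function.uncurry G))
    (hm : ∀ n, Measurable (Z n)) (hi : iIndepFun Z P)
    (hd : ∀ n, IdentDistrib (Z n) (Z 0) P P) (x z : X) (n : ℕ) :
    P {ω | trajectory G (fun k => Z k ω) x n = z}
      = P {ω | backward (fun k x => G x (Z k ω)) n x = z} := by
  have h := iid_measure_reindex hm hi hd (reverse_injective n)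
    (T := {y | trajectory G y x n = z})
    (measurable_trajectory hG x n (measurableSet_singleton z))
  refine h.symm.trans ?_
  congr 1
  ext ω
  simp only [Set.mem_ofPred_eq]
  rw [← trajectory_reverse]
  simp only [apply_ite (fun j => Z j ω)]

/-! ### Last visits and return times -/

/-- Decomposition of time `n` according to the last visit to `x`. -/
theorem sum_last_visit [MeasurableSingletonClass X] (hG : Measurable (Function.uncurry G))
    (hm : ∀ n, Measurable (Z n)) (hi : iIndepFun Z P)
    (hd : ∀ n, IdentDistrib (Z n) (Z 0) P P) (x : X) (n : ℕ) :
    ∑ k ∈ Finset.range (n + 1), P {ω | trajectory G (fun k => Z k ω) x (n - k) = x} *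
      P {ω | ∀ j, 1 ≤ j → j ≤ k → trajectory G (fun k => Z k ω) x j ≠ x} = 1 := by
  have hmeasT : ∀ k, MeasurableSet
      {y : ℕ → E | ∀ j, 1 ≤ j → j ≤ k → trajectory G y x j ≠ x} := fun k => by
    have : {y : ℕ → E | ∀ j, 1 ≤ j → j ≤ k → trajectory G y x j ≠ x}
        = ⋂ j, ⋂ (_ : 1 ≤ j), ⋂ (_ : j ≤ k), {y | trajectory G y x j = x}ᶜ := by
      ext y; simp
    rw [this]
    exact MeasurableSet.iInter fun j => MeasurableSet.iInter fun _ => MeasurableSet.iInter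
      fun _ => (measurable_trajectory hG x j (measurableSet_singleton x)).compl
  have hZ : Measurable (fun ω (k : ℕ) => Z k ω) := measurable_pi_lambda _ hm
  have key : ∀ k ∈ Finset.range (n + 1),
      P {ω | trajectory G (fun k => Z k ω) x (n - k) = x} *
      P {ω | ∀ j, 1 ≤ j → j ≤ k → trajectory G (fun k => Z k ω) x j ≠ x}
      = P {ω | trajectory G (fun k => Z k ω) x (n - k) = x ∧
          ∀ m, n - k < m → m ≤ n → trajectory G (fun k => Z k ω) x m ≠ x} := by
    intro k hk
    have hk' : k ≤ n := Nat.lt_succ_iff.1 (Finset.mem_range.1 hk)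
    have h := measure_trajectory_inter_shift hG hm hi hd x x (n - k) (hmeasT k)
    refine h.symm.trans ?_
    congr 1
    ext ω
    simp only [Set.mem_inter_iff, Set.mem_ofPred_eq]
    refine and_congr_right fun hx => ?_
    constructor
    · intro H m hm1 hm2
      have := H (m - (n - k)) (by omega) (by omega)
      have e := trajectory_add (G := G) (fun k => Z k ω) x (n - k) (m - (n - k))
      rw [hx] at e
      rwa [← e, show n - k + (m - (n - k)) = m by omega] at this
    · intro H j hj1 hj2
      have := H (n - k + j) (by omega) (by omega)
      have e := trajectory_add (G := G) (fun k => Z k ω) x (n - k) j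
      rw [hx] at e
      rwa [e] at this
  rw [Finset.sum_congr rfl key, ← measure_biUnion_finset]
  · rw [← measure_univ (μ := P)]
    congr 1
    rw [Set.eq_univ_iff_forall]
    intro ω
    classical
    -- The last visit up to time `n` exists because time `0` is a visit.
    set m := Nat.findGreatest (fun m => trajectory G (fun k => Z k ω) x m = x) n with hmdef
    have hm1 : m ≤ n := Nat.findGreatest_le n
    have hm2 : trajectory G (fun k => Z k ω) x m = x :=
      Nat.findGreatest_spec (P := fun m => trajectory G (fun k => Z k ω) x m = x)
        (Nat.zero_le n) rfl
    refine Set.mem_biUnion (x := n - m) (by simp) ⟨?_, ?_⟩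
    · rwa [Nat.sub_sub_self hm1]
    · rw [Nat.sub_sub_self hm1]
      exact fun j hj1 hj2 => Nat.findGreatest_is_greatest hj1 hj2
  · intro a ha b hb hab
    have ha' := Finset.mem_range.1 (Finset.mem_coe.1 ha)
    have hb' := Finset.mem_range.1 (Finset.mem_coe.1 hb)
    refine Set.disjoint_left.2 fun ω h1 h2 => ?_
    rcases lt_or_gt_of_ne hab with h | h
    · exact h2.2 (n - a) (by omega) (by omega) h1.1
    · exact h1.2 (n - b) (by omega) (by omega) h2.1
  · intro k _
    have : {ω | trajectory G (fun k => Z k ω) x (n - k) = x ∧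
          ∀ m, n - k < m → m ≤ n → trajectory G (fun k => Z k ω) x m ≠ x}
        = (fun ω k => Z k ω) ⁻¹' ({y | trajectory G y x (n - k) = x} ∩ ⋂ m, ⋂ (_ : n - k < m),
          ⋂ (_ : m ≤ n), {y | trajectory G y x m = x}ᶜ) := by
      ext ω; simp
    rw [this]
    exact hZ ((measurable_trajectory hG x _ (measurableSet_singleton x)).inter
      (MeasurableSet.iInter fun j => MeasurableSet.iInter fun _ => MeasurableSet.iInter
      fun _ => (measurable_trajectory hG x j (measurableSet_singleton x)).compl))

end Trajectory

/-! ### Mean return times and limits of return probabilities -/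

section Return

theorem ENat.toENNReal_eq_tsum (t : ℕ∞) :
    (t : ℝ≥0∞) = ∑' k : ℕ, if (k : ℕ∞) < t then 1 else 0 := by
  induction t using ENat.recTopCoe with
  | top => simp
  | coe n =>
    rw [tsum_eq_sum (s := Finset.range n)]
    · rw [Finset.sum_congr rfl (g := fun _ => 1)]
      · simp
      · intro k hk
        rw [if_pos]
        exact_mod_cast Finset.mem_range.1 hk
    · intro k hk
      rw [if_neg]
      simpa using hk

theorem lt_returnTime_iff {Ω X : Type*} (W : X → ℕ → Ω → X) (x : X) (ω : Ω) (k : ℕ) :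
    (k : ℕ∞) < returnTime W x ω ↔ ∀ j, 1 ≤ j → j ≤ k → W x j ω ≠ x := by
  constructor
  · intro h j h1 h2 he
    have : returnTime W x ω ≤ j := iInf₂_le j ⟨h1, he⟩
    exact absurd (h.trans_le this) (by simpa using h2)
  · intro h
    have : ((k + 1 : ℕ) : ℕ∞) ≤ returnTime W x ω := by
      refine le_iInf₂ fun j hj => ?_
      by_contra hlt
      have : j < k + 1 := by exact_mod_cast not_le.1 hlt
      exact h j hj.1 (by omega) hj.2
    refine lt_of_lt_of_le ?_ this
    exact_mod_cast k.lt_succ_self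

variable {Ω X : Type*} [MeasurableSpace Ω] [MeasurableSpace X] [MeasurableSingletonClass X]
  {P : Measure Ω}

/-- Tail-sum formula for the mean; the tails are exactly the second factors in `sum_last_visit`. -/
theorem lintegral_returnTime {W : X → ℕ → Ω → X} {x : X} (hW : ∀ n, Measurable (W x n)) :
    ∫⁻ ω, (returnTime W x ω : ℝ≥0∞) ∂P
      = ∑' k : ℕ, P {ω | ∀ j, 1 ≤ j → j ≤ k → W x j ω ≠ x} := by
  have hmeas : ∀ k : ℕ, MeasurableSet {ω | ∀ j, 1 ≤ j → j ≤ k → W x j ω ≠ x} := fun k => by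
    have : {ω | ∀ j, 1 ≤ j → j ≤ k → W x j ω ≠ x}
        = ⋂ j, ⋂ (_ : 1 ≤ j), ⋂ (_ : j ≤ k), {ω | W x j ω = x}ᶜ := by
      ext y; simp
    rw [this]
    exact MeasurableSet.iInter fun j => MeasurableSet.iInter fun _ => MeasurableSet.iInter
      fun _ => (hW j (measurableSet_singleton x)).compl
  have h1 : ∀ ω, (returnTime W x ω : ℝ≥0∞)
      = ∑' k : ℕ, {ω | ∀ j, 1 ≤ j → j ≤ k → W x j ω ≠ x}.indicator 1 ω := by
    intro ω
    rw [ENat.toENNReal_eq_tsum]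
    refine tsum_congr fun k => ?_
    classical
    rw [Set.indicator_apply]
    exact if_congr (lt_returnTime_iff W x ω k) rfl rfl
  simp_rw [h1]
  rw [lintegral_tsum fun k => (measurable_one.indicator (hmeas k)).aemeasurable]
  exact tsum_congr fun k => lintegral_indicator_one (hmeas k)

variable {E : Type*} {G : X → E → X} [MeasurableSpace E] [IsProbabilityMeasure P]
  {Z : ℕ → Ω → E}

/-- If the return probabilities have a positive limit, the state is positive recurrent. -/
theorem positiveRecurrent_of_tendsto (hG : Measurable (Function.uncurry G))
    (hm : ∀ n, Measurable (Z n)) (hi : iIndepFun Z P)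
    (hd : ∀ n, IdentDistrib (Z n) (Z 0) P P) (x : X) {c : ℝ≥0∞} (hc : c ≠ 0)
    (h : Tendsto (fun n => P {ω | trajectory G (fun k => Z k ω) x n = x}) atTop (𝓝 c)) :
    IsPositiveRecurrentState P (fun x n ω => trajectory G (fun k => Z k ω) x n) x := by
  have hZ : Measurable (fun ω (k : ℕ) => Z k ω) := measurable_pi_lambda _ hm
  rw [IsPositiveRecurrentState,
    lintegral_returnTime fun n => (measurable_trajectory hG x n).comp hZ]
  set r : ℕ → ℝ≥0∞ := fun k =>
    P {ω | ∀ j, 1 ≤ j → j ≤ k → trajectory G (fun k => Z k ω) x j ≠ x} with hr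
  have hc1 : c ≠ ⊤ := ne_top_of_le_ne_top ENNReal.one_ne_top
    (le_of_tendsto' h fun n => prob_le_one)
  -- Only the first `K` terms of the last-visit identity are kept, so the limit in `n` is taken in a
  -- finite sum.
  have hle : ∀ K, c * ∑ k ∈ Finset.range K, r k ≤ 1 := by
    intro K
    rw [Finset.mul_sum]
    have hlim : Tendsto (fun n => ∑ k ∈ Finset.range K,
        P {ω | trajectory G (fun k => Z k ω) x (n - k) = x} * r k) atTop
        (𝓝 (∑ k ∈ Finset.range K, c * r k)) := by
      refine tendsto_finsetSum _ fun k _ => ?_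
      refine ENNReal.Tendsto.mul_const (h.comp (tendsto_sub_atTop_nat k)) (Or.inr ?_)
      exact measure_ne_top _ _
    refine le_of_tendsto hlim ?_
    filter_upwards [eventually_ge_atTop K] with n hn
    rw [← sum_last_visit hG hm hi hd x n]
    exact Finset.sum_le_sum_of_subset (Finset.range_mono (by omega))
  have hsum : ∑' k, r k ≤ c⁻¹ := by
    rw [ENNReal.tsum_eq_iSup_nat]
    refine iSup_le fun K => ?_
    rw [ENNReal.le_inv_iff_mul_le, mul_comm]
    exact hle K
  exact hsum.trans_lt (by simpa [pos_iff_ne_zero] using hc)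

/-- At a positive recurrent state the return probabilities do not tend to `0`. -/
theorem not_tendsto_zero_of_positiveRecurrent (hG : Measurable (Function.uncurry G))
    (hm : ∀ n, Measurable (Z n)) (hi : iIndepFun Z P)
    (hd : ∀ n, IdentDistrib (Z n) (Z 0) P P) (x : X)
    (h : IsPositiveRecurrentState P (fun x n ω => trajectory G (fun k => Z k ω) x n) x) :
    ¬ Tendsto (fun n => P {ω | trajectory G (fun k => Z k ω) x n = x}) atTop (𝓝 0) := by
  intro hlim
  have hZ : Measurable (fun ω (k : ℕ) => Z k ω) := measurable_pi_lambda _ hm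
  rw [IsPositiveRecurrentState,
    lintegral_returnTime fun n => (measurable_trajectory hG x n).comp hZ] at h
  set r : ℕ → ℝ≥0∞ := fun k =>
    P {ω | ∀ j, 1 ≤ j → j ≤ k → trajectory G (fun k => Z k ω) x j ≠ x} with hr
  have hone := sum_last_visit hG hm hi hd x
  set u : ℕ → ℝ≥0∞ := fun n => P {ω | trajectory G (fun k => Z k ω) x n = x} with hu
  -- The sums are all `1` by the last-visit identity, yet dominated convergence with the summable
  -- bound `r` would send them to `0`.
  have hT : Tendsto (fun n => ∑' k, if k ∈ Finset.range (n + 1) then u (n - k) * r k else 0)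
      atTop (𝓝 (∑' _ : ℕ, 0)) := by
    simp_rw [← lintegral_count]
    refine tendsto_lintegral_of_dominated_convergence r (fun n => measurable_of_countable _) ?_ ?_ ?_
    · refine fun n => Eventually.of_forall fun k => ?_
      dsimp only
      split_ifs
      · exact mul_le_of_le_one_left (zero_le) prob_le_one
      · exact zero_le
    · rw [lintegral_count]; exact h.ne
    · refine Eventually.of_forall fun k => ?_
      have h1 : Tendsto (fun n => u (n - k) * r k) atTop (𝓝 (0 * r k)) :=
        ENNReal.Tendsto.mul_const (hlim.comp (tendsto_sub_atTop_nat k))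
          (Or.inr (measure_ne_top _ _))
      rw [zero_mul] at h1
      refine h1.congr' ?_
      filter_upwards [eventually_ge_atTop k] with n hn
      rw [if_pos (Finset.mem_range.2 (by omega))]
  have h1 : ∀ n, (∑' k, if k ∈ Finset.range (n + 1) then u (n - k) * r k else 0) = 1 := by
    intro n
    rw [← hone n, tsum_eq_sum (s := Finset.range (n + 1)) (fun k hk => if_neg hk)]
    exact Finset.sum_congr rfl fun k hk => if_pos hk
  simp only [h1, tsum_zero] at hT
  exact one_ne_zero (tendsto_nhds_unique tendsto_const_nhds hT)

end Return

/-! ### Lower limits of integer random walks -/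

section Walk

theorem measurable_partialSum (n : ℕ) :
    Measurable (fun y : ℕ → ℤ => ∑ k ∈ Finset.range n, y k) :=
  Finset.measurable_sum _ fun k _ => measurable_pi_apply k

theorem partialSum_shift (y : ℕ → ℤ) (m n : ℕ) :
    ∑ k ∈ Finset.range n, y (k + m)
      = ∑ k ∈ Finset.range (n + m), y k - ∑ k ∈ Finset.range m, y k := by
  rw [add_comm n m, Finset.sum_range_add]
  simp [add_comm]

/-- The sequences whose partial sums have lower limit `j`. -/
def liminfEq (j : ℤ) : Set (ℕ → ℤ) :=
  {y | (∃ᶠ n in atTop, ∑ k ∈ Finset.range n, y k = j) ∧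
    ∀ᶠ n in atTop, j ≤ ∑ k ∈ Finset.range n, y k}

theorem measurableSet_liminfEq (j : ℤ) : MeasurableSet (liminfEq j) := by
  refine MeasurableSet.inter (s₁ := {y : ℕ → ℤ | ∃ᶠ n in atTop, ∑ k ∈ Finset.range n, y k = j})
    (s₂ := {y : ℕ → ℤ | ∀ᶠ n in atTop, j ≤ ∑ k ∈ Finset.range n, y k}) ?_ ?_
  · simp only [Filter.frequently_atTop]
    exact measurableSet_setOfPred.2 (Measurable.forall fun a => Measurable.exists fun b =>
      (measurable_const.and (measurableSet_setOfPred.1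
        (measurable_partialSum b (measurableSet_singleton j)))))
  · simp only [Filter.eventually_atTop]
    exact measurableSet_setOfPred.2 (Measurable.exists fun a => Measurable.forall fun b =>
      (measurable_const.imp (measurableSet_setOfPred.1
        (measurable_partialSum b (measurableSet_Ici (a := j))))))

/-- Dropping the first step lowers all later partial sums by `y 0`. For an i.i.d. sequence this
becomes a convolution equation for the law of the lower limit. -/
theorem shift_mem_liminfEq (y : ℕ → ℤ) (j : ℤ) :
    (fun k => y (k + 1)) ∈ liminfEq (j - y 0) ↔ y ∈ liminfEq j := by
  simp only [liminfEq, Set.mem_ofPred_eq, partialSum_shift, Finset.sum_range_one,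
    sub_left_inj, sub_le_sub_iff_right]
  refine and_congr ?_ ?_
  · rw [← Filter.frequently_map (m := fun n => n + 1)
      (P := fun n => ∑ k ∈ Finset.range n, y k = j), map_add_atTop_eq_nat]
  · rw [← Filter.eventually_map (m := fun n => n + 1)
      (P := fun n => j ≤ ∑ k ∈ Finset.range n, y k), map_add_atTop_eq_nat]

theorem disjoint_liminfEq {i j : ℤ} (h : i ≠ j) : Disjoint (liminfEq i) (liminfEq j) := by
  refine Set.disjoint_left.2 fun y hi hj => h (le_antisymm ?_ ?_)
  · obtain ⟨n, h1, h2⟩ := (hj.1.and_eventually hi.2).exists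
    omega
  · obtain ⟨n, h1, h2⟩ := (hi.1.and_eventually hj.2).exists
    omega

/-- Some level is undershot infinitely often; the least integer level with `S_n ≤ j` infinitely
often exists by the lower bound and is the lower limit. -/
theorem exists_mem_liminfEq {y : ℕ → ℤ}
    (hb : ∃ B : ℤ, ∀ᶠ n in atTop, B ≤ ∑ k ∈ Finset.range n, y k)
    (hy : ¬ Tendsto (fun n => ∑ k ∈ Finset.range n, y k) atTop atTop) :
    ∃ j, y ∈ liminfEq j := by
  obtain ⟨B, hB⟩ := hb
  rw [tendsto_atTop] at hy
  push Not at hy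
  obtain ⟨K, hK⟩ := hy
  obtain ⟨j, hj, hmin⟩ := Int.exists_least_of_bdd
    (P := fun j => ∃ᶠ n in atTop, ∑ k ∈ Finset.range n, y k ≤ j)
    ⟨B, fun z hz => by
      obtain ⟨n, h1, h2⟩ := (hz.and_eventually hB).exists
      omega⟩
    ⟨K, hK.mono fun n hn => hn.le⟩
  have hlow : ∀ᶠ n in atTop, j ≤ ∑ k ∈ Finset.range n, y k := by
    by_contra hcon
    have := hmin (j - 1) ((not_eventually.1 hcon).mono fun n hn => by omega)
    omega
  exact ⟨j, (hj.and_eventually hlow).mono fun n hn => le_antisymm hn.1 hn.2, hlow⟩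

variable {Ω : Type*} [MeasurableSpace Ω] {P : Measure Ω} [IsProbabilityMeasure P]
  {Z : ℕ → Ω → ℤ}

theorem hasSum_measureReal_iUnion {Ω ι : Type*} [MeasurableSpace Ω] [Countable ι]
    {P : Measure Ω} [IsFiniteMeasure P] {f : ι → Set Ω}
    (hd : Pairwise (Function.onFun Disjoint f)) (hf : ∀ i, MeasurableSet (f i)) :
    HasSum (fun i => P.real (f i)) (P.real (⋃ i, f i)) := by
  have h := measure_iUnion (μ := P) hd hf
  simp only [Measure.real]
  rw [h, ENNReal.tsum_toReal_eq fun i => measure_ne_top _ _]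
  exact (ENNReal.summable_toReal (h ▸ measure_ne_top _ _)).hasSum

theorem measureReal_inter_shift (hm : ∀ n, Measurable (Z n)) (hi : iIndepFun Z P)
    (hd : ∀ n, IdentDistrib (Z n) (Z 0) P P) {B : Set ℤ} {T : Set (ℕ → ℤ)}
    (hT : MeasurableSet T) :
    P.real ({ω | Z 0 ω ∈ B} ∩ {ω | (fun k => Z (k + 1) ω) ∈ T})
      = P.real {ω | Z 0 ω ∈ B} * P.real {ω | (fun k => Z k ω) ∈ T} := by
  have := iid_measure_inter_shift hm hi hd 1 (s := {ω | Z 0 ω ∈ B}) ?_ hT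
  · rw [Measure.real, this, ENNReal.toReal_mul]; rfl
  · have h : Measurable[⨆ k ∈ Set.Iio 1, MeasurableSpace.comap (Z k) inferInstance] (Z 0) :=
      Measurable.mono (comap_measurable (Z 0)) (le_iSup₂_of_le 0 (by simp) le_rfl) le_rfl
    exact h (MeasurableSet.of_discrete (s := B))

/-- The lower limit of a random walk that moves up with positive probability is not finite. -/
theorem measure_liminfEq_eq_zero (hm : ∀ n, Measurable (Z n)) (hi : iIndepFun Z P)
    (hd : ∀ n, IdentDistrib (Z n) (Z 0) P P) (hpos : 0 < P {ω | 0 < Z 0 ω}) (j : ℤ) :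
    P {ω | (fun k => Z k ω) ∈ liminfEq j} = 0 := by
  have hZ : Measurable (fun ω (k : ℕ) => Z k ω) := measurable_pi_lambda _ hm
  set μ : ℤ → ℝ := fun j => P.real {ω | (fun k => Z k ω) ∈ liminfEq j} with hμ
  have hmeas : ∀ j, MeasurableSet {ω | (fun k => Z k ω) ∈ liminfEq j} :=
    fun j => hZ (measurableSet_liminfEq j)
  have hdisj : Pairwise (Function.onFun Disjoint fun j : ℤ =>
      {ω | (fun k => Z k ω) ∈ liminfEq j}) := fun a b hab =>
    Set.disjoint_left.2 fun ω h1 h2 => Set.disjoint_left.1 (disjoint_liminfEq hab) h1 h2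
  have hsum : Summable μ := (hasSum_measureReal_iUnion hdisj hmeas).summable
  have hfin : ∀ c, 0 < c → {j | c ≤ μ j}.Finite := fun c hc => by
    have := (tendsto_order.1 hsum.tendsto_cofinite_zero).2 c hc
    rw [eventually_cofinite] at this
    simpa using this
  by_contra hj
  have hμj : 0 < μ j := ENNReal.toReal_pos hj (measure_ne_top _ _)
  -- Summability leaves finitely many levels of mass at least `μ j`, so the maximal mass is
  -- attained.
  obtain ⟨i, hi1, hi2⟩ := Set.exists_max_image {l | μ j ≤ μ l} μ (hfin _ hμj) ⟨j, le_refl (μ j)⟩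
  have hmax : ∀ l, μ l ≤ μ i := fun l => by
    by_cases h : μ j ≤ μ l
    · exact hi2 l h
    · exact (not_le.1 h).le.trans hi1
  have hi0 : 0 < μ i := hμj.trans_le hi1
  obtain ⟨e, he, hpe⟩ : ∃ e : ℤ, 0 < e ∧ 0 < P.real {ω | Z 0 ω = e} := by
    by_contra hcon
    push Not at hcon
    refine hpos.ne' ?_
    have hsub : {ω | 0 < Z 0 ω} ⊆ ⋃ e : {e : ℤ // 0 < e}, {ω | Z 0 ω = e} := fun ω hω =>
      Set.mem_iUnion.2 ⟨⟨Z 0 ω, hω⟩, rfl⟩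
    refine measure_mono_null hsub (measure_iUnion_null fun e => ?_)
    have := le_antisymm (hcon e e.2) measureReal_nonneg
    rwa [measureReal_eq_zero_iff] at this
  -- Maximum principle: `μ l` is the average of `μ (l - a)` over the step law, so at a maximum every
  -- `l - a` with `a` of positive probability is again a maximum.
  have hstep : ∀ l, μ l = μ i → μ (l - e) = μ i := by
    intro l hl
    refine le_antisymm (hmax _) ?_
    have hsplit : ∀ l, HasSum (fun a : ℤ => P.real {ω | Z 0 ω = a} * μ (l - a)) (μ l) := by
      intro l
      have h1 : {ω | (fun k => Z k ω) ∈ liminfEq l}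
          = ⋃ a : ℤ, ({ω | Z 0 ω ∈ ({a} : Set ℤ)} ∩
            {ω | (fun k => Z (k + 1) ω) ∈ liminfEq (l - a)}) := by
        ext ω
        simp only [Set.mem_iUnion, Set.mem_inter_iff, Set.mem_ofPred_eq, Set.mem_singleton_iff,
          exists_eq_left', ← shift_mem_liminfEq (fun k => Z k ω) l]
      have h2 := hasSum_measureReal_iUnion (P := P) (f := fun a : ℤ =>
        ({ω | Z 0 ω ∈ ({a} : Set ℤ)} ∩ {ω | (fun k => Z (k + 1) ω) ∈ liminfEq (l - a)}))
        (fun a b hab => Set.disjoint_left.2 fun ω h h' => hab (h.1.symm.trans h'.1))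
        (fun a => (hm 0 (measurableSet_singleton a)).inter
          ((measurable_pi_lambda _ fun k => hm (k + 1)) (measurableSet_liminfEq _)))
      rw [← h1] at h2
      simp only [measureReal_inter_shift hm hi hd (measurableSet_liminfEq _)] at h2
      exact h2
    have hprob : HasSum (fun a : ℤ => P.real {ω | Z 0 ω = a} * μ i) (μ i) := by
      have h2 := hasSum_measureReal_iUnion (P := P) (f := fun a : ℤ => {ω | Z 0 ω = a})
        (fun a b hab => Set.disjoint_left.2 fun ω h h' => hab (h.symm.trans h'))
        (fun a => hm 0 (measurableSet_singleton a))
      have h3 : (⋃ a : ℤ, {ω | Z 0 ω = a}) = Set.univ := by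
        ext ω; simp
      rw [h3, probReal_univ] at h2
      simpa using h2.mul_right (μ i)
    have hdiff := hprob.sub (hsplit l)
    rw [hl, sub_self] at hdiff
    have hz := (hasSum_zero_iff_of_nonneg fun a => by
      rw [← mul_sub]
      exact mul_nonneg measureReal_nonneg (sub_nonneg.2 (hmax _))).1 hdiff
    have := congrFun hz e
    simp only [Pi.zero_apply, ← mul_sub, mul_eq_zero, hpe.ne', false_or] at this
    linarith
  have hall : ∀ n : ℕ, μ (i - n * e) = μ i := by
    intro n
    induction n with
    | zero => simp
    | succ n ih =>
      have := hstep _ ih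
      rw [← this]
      congr 1
      push_cast
      ring
  -- The maximum is attained at the infinitely many levels `i - n * e`, against summability.
  refine Set.not_infinite.2 (hfin (μ i) hi0) ?_
  refine Set.infinite_of_injective_forall_mem (f := fun n : ℕ => i - n * e) ?_ fun n => (hall n).ge
  intro a b hab
  have : (a : ℤ) * e = b * e := by simpa using hab
  exact_mod_cast mul_right_cancel₀ he.ne' this

/-- A random walk that moves up with positive probability and stays nonnegative with positive
probability tends to infinity. -/
theorem walk_tendsto_atTop (hm : ∀ n, Measurable (Z n)) (hi : iIndepFun Z P)
    (hd : ∀ n, IdentDistrib (Z n) (Z 0) P P) (hpos : 0 < P {ω | 0 < Z 0 ω})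
    (h : P {ω | ∀ n, 0 ≤ ∑ k ∈ Finset.range n, Z k ω} ≠ 0) :
    ∀ᵐ ω ∂P, Tendsto (fun n => ∑ k ∈ Finset.range n, Z k ω) atTop atTop := by
  have hZ : Measurable (fun ω (k : ℕ) => Z k ω) := measurable_pi_lambda _ hm
  -- Unlike staying nonnegative, being bounded below is shift invariant, so the zero-one law applies
  -- to it.
  set T : Set (ℕ → ℤ) := {y | ∃ B : ℤ, ∀ᶠ n in atTop, B ≤ ∑ k ∈ Finset.range n, y k} with hT
  have hTm : MeasurableSet T := by
    simp only [hT, Filter.eventually_atTop]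
    exact measurableSet_setOfPred.2 (Measurable.exists fun B => Measurable.exists fun a =>
      Measurable.forall fun b => (measurable_const.imp (measurableSet_setOfPred.1
        (measurable_partialSum b (measurableSet_Ici (a := B))))))
  have hinv : ∀ (y : ℕ → ℤ) (m : ℕ), (fun k => y (k + m)) ∈ T ↔ y ∈ T := by
    intro y m
    simp only [hT, Set.mem_ofPred_eq, partialSum_shift]
    have e : ∀ B : ℤ, (∀ᶠ n in atTop, B ≤ ∑ k ∈ Finset.range (n + m), y k) ↔
        ∀ᶠ n in atTop, B ≤ ∑ k ∈ Finset.range n, y k := fun B => by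
      rw [← Filter.eventually_map (m := fun n => n + m)
        (P := fun n => B ≤ ∑ k ∈ Finset.range n, y k), map_add_atTop_eq_nat]
    simp_rw [← e]
    constructor
    · rintro ⟨B, hB⟩
      exact ⟨B + ∑ k ∈ Finset.range m, y k, hB.mono fun n hn => by omega⟩
    · rintro ⟨B, hB⟩
      exact ⟨B - ∑ k ∈ Finset.range m, y k, hB.mono fun n hn => by omega⟩
  have hne : P {ω | (fun k => Z k ω) ∈ T} ≠ 0 := fun h0 => h (measure_mono_null
    (t := {ω | (fun k => Z k ω) ∈ T}) (fun ω hω => ⟨0, Eventually.of_forall hω⟩) h0)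
  have hone := (iid_zero_or_one_of_shift_invariant hm hi hTm hinv).resolve_left hne
  have hae : ∀ᵐ ω ∂P, (fun k => Z k ω) ∈ T := (prob_compl_eq_zero_iff (hZ hTm)).2 hone
  have hnot : ∀ᵐ ω ∂P, ∀ j, (fun k => Z k ω) ∉ liminfEq j := ae_all_iff.2 fun j => by
    rw [ae_iff]
    simpa using measure_liminfEq_eq_zero hm hi hd hpos j
  filter_upwards [hae, hnot] with ω h1 h2
  by_contra hcon
  obtain ⟨j, hj⟩ := exists_mem_liminfEq h1 hcon
  exact h2 j hj

end Walk

/-! ### Consequences of a backward limit that forgets the starting point -/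

section BackwardLimit

variable {Ω X E : Type*} [MeasurableSpace Ω] [MeasurableSpace X] [MeasurableSpace E]
  [MeasurableSingletonClass X] {P : Measure Ω} [IsProbabilityMeasure P]
  {G : X → E → X} {Z : ℕ → Ω → E} {V : (ℕ → E) → X}

/-- Almost sure convergence of the backward iteration makes the transition probabilities
converge. -/
theorem tendsto_measure_trajectory (hG : Measurable (Function.uncurry G))
    (hm : ∀ n, Measurable (Z n)) (hi : iIndepFun Z P)
    (hd : ∀ n, IdentDistrib (Z n) (Z 0) P P) (hV : Measurable V)
    (hlim : ∀ᵐ ω ∂P, ∀ x, ∀ᶠ n in atTop,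
      backward (fun k x => G x (Z k ω)) n x = V (fun k => Z k ω)) (x z : X) :
    Tendsto (fun n => P {ω | trajectory G (fun k => Z k ω) x n = z}) atTop
      (𝓝 (P {ω | V (fun k => Z k ω) = z})) := by
  have hZ : Measurable (fun ω (k : ℕ) => Z k ω) := measurable_pi_lambda _ hm
  simp_rw [measure_trajectory_eq_backward hG hm hi hd]
  refine tendsto_measure_of_ae_tendsto_indicator_of_isFiniteMeasure atTop
    ((hV.comp hZ) (measurableSet_singleton z))
    (fun n => ((measurable_backward hG x n).comp hZ) (measurableSet_singleton z)) ?_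
  filter_upwards [hlim] with ω hω
  filter_upwards [hω x] with n hn
  simp only [hn]

variable [Countable X]

/-- The one-step decomposition of the transition probabilities. -/
theorem measure_trajectory_succ (hG : Measurable (Function.uncurry G))
    (hm : ∀ n, Measurable (Z n)) (hi : iIndepFun Z P)
    (hd : ∀ n, IdentDistrib (Z n) (Z 0) P P) {κ : Kernel X X}
    (hκ : ∀ w, κ w = P.map (fun ω => G w (Z 0 ω))) (x z : X) (n : ℕ) :
    P {ω | trajectory G (fun k => Z k ω) x (n + 1) = z}
      = ∫⁻ w, P {ω | trajectory G (fun k => Z k ω) w n = z} ∂(κ x) := by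
  have hm1 : Measurable (fun ω => G x (Z 0 ω)) := hG.comp (measurable_const.prodMk (hm 0))
  have hs : Measurable (fun ω (k : ℕ) => Z (k + 1) ω) := measurable_pi_lambda _ fun k => hm (k + 1)
  have hset : {ω | trajectory G (fun k => Z k ω) x (n + 1) = z}
      = ⋃ w, ({ω | trajectory G (fun k => Z k ω) x 1 = w} ∩
        {ω | (fun k => Z (k + 1) ω) ∈ {y | trajectory G y w n = z}}) := by
    ext ω
    simp only [Set.mem_ofPred_eq, Set.mem_iUnion, Set.mem_inter_iff, exists_eq_left']
    rw [add_comm n 1, trajectory_add]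
  rw [hset, measure_iUnion, lintegral_countable']
  · refine tsum_congr fun w => ?_
    rw [measure_trajectory_inter_shift hG hm hi hd x w 1
      (T := {y | trajectory G y w n = z}) (measurable_trajectory hG w n (measurableSet_singleton z)),
      mul_comm, hκ,
      Measure.map_apply hm1 (measurableSet_singleton w)]
    rfl
  · exact fun a b hab => Set.disjoint_left.2 fun ω h h' => hab (h.1.symm.trans h'.1)
  · exact fun w => (hm1 (measurableSet_singleton w)).inter
      (hs (measurable_trajectory hG w n (measurableSet_singleton z)))

theorem lintegral_measure_trajectory_of_invariant (hG : Measurable (Function.uncurry G))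
    (hm : ∀ n, Measurable (Z n)) (hi : iIndepFun Z P)
    (hd : ∀ n, IdentDistrib (Z n) (Z 0) P P) {κ : Kernel X X}
    (hκ : ∀ w, κ w = P.map (fun ω => G w (Z 0 ω))) {ν : Measure X} (hν : κ.Invariant ν)
    (z : X) (n : ℕ) :
    ∫⁻ x, P {ω | trajectory G (fun k => Z k ω) x n = z} ∂ν = ν {z} := by
  induction n with
  | zero =>
    rw [← lintegral_indicator_one (measurableSet_singleton z)]
    refine lintegral_congr fun x => ?_
    by_cases h : x = z <;> simp [trajectory, h]
  | succ n ih =>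
    simp_rw [measure_trajectory_succ hG hm hi hd hκ _ z n]
    rw [← Measure.lintegral_bind κ.aemeasurable (measurable_of_countable _).aemeasurable,
      hν.def, ih]

/-- The law of the backward limit is invariant. -/
theorem invariant_map_backwardLimit (hG : Measurable (Function.uncurry G))
    (hm : ∀ n, Measurable (Z n)) (hi : iIndepFun Z P)
    (hd : ∀ n, IdentDistrib (Z n) (Z 0) P P) (hV : Measurable V)
    (hlim : ∀ᵐ ω ∂P, ∀ x, ∀ᶠ n in atTop,
      backward (fun k x => G x (Z k ω)) n x = V (fun k => Z k ω)) {κ : Kernel X X}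
    (hκ : ∀ w, κ w = P.map (fun ω => G w (Z 0 ω))) :
    κ.Invariant (P.map fun ω => V (fun k => Z k ω)) := by
  have hZ : Measurable (fun ω (k : ℕ) => Z k ω) := measurable_pi_lambda _ hm
  have hVZ : Measurable (fun ω => V (fun k => Z k ω)) := hV.comp hZ
  have hs : Measurable (fun ω (k : ℕ) => Z (k + 1) ω) := measurable_pi_lambda _ fun k => hm (k + 1)
  have hm1 : ∀ x, Measurable (fun ω => G x (Z 0 ω)) := fun x =>
    hG.comp (measurable_const.prodMk (hm 0))
  set T : Set (ℕ → E) :=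
    {y | ∀ x, ∀ᶠ n in atTop, backward (fun k x => G x (y k)) n x = V y} with hT
  have hTm : MeasurableSet T := by
    simp only [hT, Filter.eventually_atTop]
    exact measurableSet_setOfPred.2 (Measurable.forall fun x => Measurable.exists fun a =>
      Measurable.forall fun b => (measurable_const.imp (measurableSet_setOfPred.1
        (measurableSet_eq_fun (measurable_backward hG x b) hV))))
  have hTae : P {ω | (fun k => Z k ω) ∈ T} = 1 := (prob_compl_eq_zero_iff (hZ hTm)).1 hlim
  have hshift : ∀ᵐ ω ∂P, (fun k => Z (k + 1) ω) ∈ T := by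
    refine (prob_compl_eq_zero_iff (hs hTm)).2 ?_
    rw [← hTae]
    exact iid_measure_reindex hm hi hd (σ := fun k => k + 1) (add_left_injective 1) hTm
  have hfix : ∀ᵐ ω ∂P, V (fun k => Z k ω) = G (V fun k => Z (k + 1) ω) (Z 0 ω) := by
    filter_upwards [hlim, hshift] with ω h1 h2
    -- Any starting point would do here: both convergences hold from every start outside one null
    -- set.
    have h3 := h2 (V fun k => Z (k + 1) ω)
    obtain ⟨n, hn1, hn2⟩ :=
      (((tendsto_add_atTop_nat 1).eventually (h1 (V fun k => Z (k + 1) ω))).and h3).exists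
    rw [← hn1, backward_succ_shift, hn2]
  refine Measure.ext_iff_singleton.2 fun z => ?_
  rw [Measure.bind_apply (measurableSet_singleton z) κ.aemeasurable, lintegral_countable',
    Measure.map_apply hVZ (measurableSet_singleton z)]
  have hset : P ((fun ω => V (fun k => Z k ω)) ⁻¹' {z})
      = P (⋃ w, ({ω | G w (Z 0 ω) = z} ∩ {ω | (fun k => Z (k + 1) ω) ∈ {y | V y = w}})) := by
    refine measure_congr ?_
    filter_upwards [hfix] with ω hω
    refine propext ?_
    change (V (fun k => Z k ω) = z) ↔ ω ∈ ⋃ w, _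
    simp [hω]
  rw [hset, measure_iUnion]
  · refine tsum_congr fun w => ?_
    have := measure_trajectory_inter_shift hG hm hi hd w z 1
      (T := {y | V y = w}) (hV (measurableSet_singleton w))
    refine Eq.trans ?_ this.symm
    rw [hκ, Measure.map_apply (hm1 w) (measurableSet_singleton z),
      Measure.map_apply hVZ (measurableSet_singleton w)]
    rfl
  · exact fun a b hab => Set.disjoint_left.2 fun ω h h' => hab (h.2.symm.trans h'.2)
  · exact fun w => (hm1 w (measurableSet_singleton z)).inter
      (hs (hV (measurableSet_singleton w)))

/-- The law of the backward limit is the only invariant probability measure. -/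
theorem eq_map_backwardLimit_of_invariant (hG : Measurable (Function.uncurry G))
    (hm : ∀ n, Measurable (Z n)) (hi : iIndepFun Z P)
    (hd : ∀ n, IdentDistrib (Z n) (Z 0) P P) (hV : Measurable V)
    (hlim : ∀ᵐ ω ∂P, ∀ x, ∀ᶠ n in atTop,
      backward (fun k x => G x (Z k ω)) n x = V (fun k => Z k ω)) {κ : Kernel X X}
    (hκ : ∀ w, κ w = P.map (fun ω => G w (Z 0 ω))) {ν : Measure X} [IsProbabilityMeasure ν]
    (hν : κ.Invariant ν) : ν = P.map fun ω => V (fun k => Z k ω) := by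
  have hZ : Measurable (fun ω (k : ℕ) => Z k ω) := measurable_pi_lambda _ hm
  have hVZ : Measurable (fun ω => V (fun k => Z k ω)) := hV.comp hZ
  refine Measure.ext_iff_singleton.2 fun z => ?_
  rw [Measure.map_apply hVZ (measurableSet_singleton z)]
  have hT : Tendsto (fun n => ∫⁻ x, P {ω | trajectory G (fun k => Z k ω) x n = z} ∂ν) atTop
      (𝓝 (∫⁻ _, P {ω | V (fun k => Z k ω) = z} ∂ν)) := by
    refine tendsto_lintegral_of_dominated_convergence (fun _ => 1)
      (fun n => measurable_of_countable _) ?_ (by simp) ?_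
    · exact fun n => Eventually.of_forall fun x => prob_le_one
    · exact Eventually.of_forall fun x => tendsto_measure_trajectory hG hm hi hd hV hlim x z
  simp only [lintegral_measure_trajectory_of_invariant hG hm hi hd hκ hν, lintegral_const,
    measure_univ, mul_one] at hT
  exact tendsto_nhds_unique tendsto_const_nhds hT

/-- The states charged by the law of the backward limit are the only essential class, and the
chain is positive recurrent there. -/
theorem exists_unique_essentialClass (hG : Measurable (Function.uncurry G))
    (hm : ∀ n, Measurable (Z n)) (hi : iIndepFun Z P)
    (hd : ∀ n, IdentDistrib (Z n) (Z 0) P P) (hV : Measurable V)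
    (hlim : ∀ᵐ ω ∂P, ∀ x, ∀ᶠ n in atTop,
      backward (fun k x => G x (Z k ω)) n x = V (fun k => Z k ω)) :
    ∃ C : Set X, IsPositiveRecurrentIn P (fun x n ω => trajectory G (fun k => Z k ω) x n) C ∧
      ∀ C' : Set X, IsEssentialClass P (fun x n ω => trajectory G (fun k => Z k ω) x n) C' →
        C' = C := by
  have hZ : Measurable (fun ω (k : ℕ) => Z k ω) := measurable_pi_lambda _ hm
  have hVZ : Measurable (fun ω => V (fun k => Z k ω)) := hV.comp hZ
  -- The atoms of the limit law are the states whose transition probabilities have a positive limit,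
  -- from every start.
  set C : Set X := {z | P {ω | V (fun k => Z k ω) = z} ≠ 0} with hC
  have hacc : ∀ x, ∀ z ∈ C,
      Accessible P (fun x n ω => trajectory G (fun k => Z k ω) x n) x z := by
    intro x z hz
    exact ((tendsto_measure_trajectory hG hm hi hd hV hlim x z).eventually
      (lt_mem_nhds (pos_iff_ne_zero.2 hz))).exists
  have habs : ∀ x ∈ C, ∀ n : ℕ, ∀ᵐ ω ∂P, trajectory G (fun k => Z k ω) x n ∈ C := by
    intro x hx n
    set κ : Kernel X X := Kernel.ofFunOfCountable fun w => P.map (fun ω => G w (Z 0 ω)) with hκ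
    have hinv := invariant_map_backwardLimit hG hm hi hd hV hlim (κ := κ) fun w => rfl
    -- The invariant law gives `z` no mass, so no state it charges can lead to `z` in `n` steps.
    have h0 : ∀ z, z ∉ C → P {ω | trajectory G (fun k => Z k ω) x n = z} = 0 := by
      intro z hz
      have h1 := lintegral_measure_trajectory_of_invariant hG hm hi hd (κ := κ) (fun w => rfl)
        hinv z n
      rw [Measure.map_apply hVZ (measurableSet_singleton z)] at h1
      have h2 : P ((fun ω => V fun k => Z k ω) ⁻¹' {z}) = 0 := not_not.1 hz
      rw [h2, lintegral_countable', ENNReal.tsum_eq_zero] at h1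
      have h3 := h1 x
      rw [Measure.map_apply hVZ (measurableSet_singleton x)] at h3
      exact (mul_eq_zero.1 h3).resolve_right hx
    have hsub : {ω | ¬ trajectory G (fun k => Z k ω) x n ∈ C}
        ⊆ ⋃ z : {z // z ∉ C}, {ω | trajectory G (fun k => Z k ω) x n = z} := fun ω hω =>
      Set.mem_iUnion.2 ⟨⟨_, hω⟩, rfl⟩
    exact measure_mono_null hsub (measure_iUnion_null fun z => h0 z z.2)
  have hne : C.Nonempty := by
    by_contra hcon
    have h0 : ∀ z, P {ω | V (fun k => Z k ω) = z} = 0 := fun z =>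
      not_not.1 fun hz => hcon ⟨z, hz⟩
    have h1 : (⋃ z, {ω | V (fun k => Z k ω) = z}) = Set.univ := by
      ext ω; simp
    have h2 := measure_iUnion_null h0
    rw [h1, measure_univ] at h2
    exact one_ne_zero h2
  refine ⟨C, ⟨⟨hne, fun x _ y hy => hacc x y hy, habs⟩, fun x hx => ?_⟩, fun C' hC' => ?_⟩
  · exact positiveRecurrent_of_tendsto hG hm hi hd x hx
      (tendsto_measure_trajectory hG hm hi hd hV hlim x x)
  -- An absorbing set contains all states accessible from it. Hence `C'` swallows `C`, and
  -- irreducibility of `C'` then forces it back into `C`.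
  · have hmem : ∀ D : Set X, (∀ x ∈ D, ∀ n : ℕ, ∀ᵐ ω ∂P, trajectory G (fun k => Z k ω) x n ∈ D) →
        ∀ x ∈ D, ∀ z, Accessible P (fun x n ω => trajectory G (fun k => Z k ω) x n) x z →
          z ∈ D := by
      rintro D hD x hx z ⟨n, hn⟩
      by_contra hz
      refine hn.ne' (measure_mono_null (fun ω hω => ?_) (hD x hx n))
      intro (h : trajectory G (fun k => Z k ω) x n ∈ D)
      rw [show trajectory G (fun k => Z k ω) x n = z from hω] at h
      exact hz h
    obtain ⟨x, hx⟩ := hC'.nonempty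
    have hsub : C ⊆ C' := fun z hz => hmem C' hC'.absorbing x hx z (hacc x z hz)
    obtain ⟨c, hc⟩ := hne
    exact Set.Subset.antisymm
      (fun z hz => hmem C habs c hc z (hC'.irreducible c (hsub hc) z hz)) hsub

end BackwardLimit

/-! ### Lindley recursions and running maxima of the walk -/

section LindleyProcess

/-- One step of the Lindley recursion. -/
def lindleyStep (w : ℕ) (z : ℤ) : ℕ := ((w : ℤ) - z).toNat

/-- One step of the multidimensional Lindley recursion. -/
def multiLindleyStep {d : ℕ} (w : Fin d → ℕ) (z : Fin d → ℤ) : Fin d → ℕ :=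
  fun i => lindleyStep (w i) (z i)

theorem lindley_eq_trajectory (y : ℕ → ℤ) (w n : ℕ) :
    lindley y w n = trajectory lindleyStep y w n := by
  induction n with
  | zero => rfl
  | succ n ih => rw [lindley, trajectory, ih, lindleyStep]

theorem multiLindley_eq_trajectory {Ω : Type*} {d : ℕ} (Y : ℕ → Ω → Fin d → ℤ) :
    multiLindley Y = fun w n ω => trajectory multiLindleyStep (fun k => Y k ω) w n := by
  funext w n ω
  induction n with
  | zero => rfl
  | succ n ih =>
    rw [trajectory, ← ih]
    rfl

theorem backward_apply {ι α : Type*} (f : ℕ → ι → α → α) (n : ℕ) (x : ι → α) (i : ι) :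
    backward (fun k x i => f k i (x i)) n x i = backward (fun k => f k i) n (x i) := by
  induction n generalizing x with
  | zero => rfl
  | succ n ih => exact ih _

/-- The running maximum of `0` and the negated partial sums. -/
def runMax (y : ℕ → ℤ) : ℕ → ℕ
  | 0 => 0
  | n + 1 => max (runMax y n) (-∑ k ∈ Finset.range (n + 1), y k).toNat

theorem monotone_runMax (y : ℕ → ℤ) : Monotone (runMax y) :=
  monotone_nat_of_le_succ fun _ => le_max_left _ _

theorem cast_runMax_succ (y : ℕ → ℤ) (n : ℕ) :
    (runMax y (n + 1) : ℤ) = max (runMax y n : ℤ) (-∑ k ∈ Finset.range (n + 1), y k) := by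
  rw [runMax]
  omega

theorem runMax_eq_zero_iff (y : ℕ → ℤ) (n : ℕ) :
    runMax y n = 0 ↔ ∀ m ≤ n, 0 ≤ ∑ k ∈ Finset.range m, y k := by
  induction n with
  | zero => simp [runMax]
  | succ n ih =>
    have h := cast_runMax_succ y n
    constructor
    · intro h0 m hm
      rcases hm.lt_or_eq with h1 | rfl
      · exact ih.1 (by omega) m (by omega)
      · omega
    · intro h0
      have h1 := ih.2 fun m hm => h0 m (by omega)
      have h2 := h0 (n + 1) le_rfl
      omega

/-- The start meets only the full sum, while truncations at `0` leave the earlier negated sums. The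
running maximum stops at `n` because the innermost truncation contributes `-S_n`. -/
theorem backward_lindleyStep_succ (y : ℕ → ℤ) (n w : ℕ) :
    ((backward (fun k w => lindleyStep w (y k)) (n + 1) w : ℕ) : ℤ)
      = max (runMax y n : ℤ) (w - ∑ k ∈ Finset.range (n + 1), y k) := by
  induction n generalizing w with
  | zero => simp [backward, lindleyStep, runMax]; omega
  | succ n ih =>
    rw [backward, Function.comp, ih, cast_runMax_succ, Finset.sum_range_succ y (n + 1),
      lindleyStep]
    omega

theorem backward_lindleyStep_zero (y : ℕ → ℤ) (n : ℕ) :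
    backward (fun k w => lindleyStep w (y k)) n 0 = runMax y n := by
  cases n with
  | zero => rfl
  | succ n =>
    have h1 := backward_lindleyStep_succ y n 0
    have h2 := cast_runMax_succ y n
    omega

theorem backward_real_succ (y : ℕ → ℤ) (n : ℕ) (x : ℝ) :
    backward (fun k x => max (x - (y k : ℝ)) 0) (n + 1) x
      = max (runMax y n : ℝ) (x - ((∑ k ∈ Finset.range (n + 1), y k : ℤ) : ℝ)) := by
  induction n generalizing x with
  | zero => simp [backward, runMax, max_comm]
  | succ n ih =>
    have h : (runMax y (n + 1) : ℝ)
        = max (runMax y n : ℝ) (-((∑ k ∈ Finset.range (n + 1), y k : ℤ) : ℝ)) := by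
      exact_mod_cast congrArg (Int.cast : ℤ → ℝ) (cast_runMax_succ y n)
    rw [backward, Function.comp, ih, h, Finset.sum_range_succ y (n + 1), ← max_sub_sub_right,
      max_comm (x - _ - _), ← max_assoc]
    push_cast
    ring_nf

/-- The supremum of `0` and the negated partial sums. -/
noncomputable def supMax (y : ℕ → ℤ) : ℕ := ⨆ n, runMax y n

theorem measurable_runMax (n : ℕ) : Measurable (fun y => runMax y n) := by
  induction n with
  | zero => exact measurable_const
  | succ n ih =>
    exact ih.max ((measurable_of_countable Int.toNat).comp (measurable_partialSum (n + 1)).neg)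

theorem measurable_supMax : Measurable supMax := Measurable.iSup measurable_runMax

/-- Once the partial sums stay nonnegative, their negatives no longer raise the maximum. The family
is then bounded, so the supremum in `supMax` is a genuine, attained one. -/
theorem eventually_runMax_eq {y : ℕ → ℤ}
    (hy : Tendsto (fun n => ∑ k ∈ Finset.range n, y k) atTop atTop) :
    ∀ᶠ n in atTop, runMax y n = supMax y := by
  obtain ⟨N, hN⟩ := eventually_atTop.1 (hy.eventually_ge_atTop 0)
  have hconst : ∀ n ≥ N, runMax y n = runMax y N := by
    intro n hn
    induction n, hn using Nat.le_induction with
    | base => rfl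
    | succ n hn ih =>
      have h1 := cast_runMax_succ y n
      have h2 := hN (n + 1) (by omega)
      omega
  have hle : ∀ n, runMax y n ≤ runMax y N := fun n => by
    rcases le_total n N with h | h
    · exact monotone_runMax y h
    · exact (hconst n h).le
  have hsup : supMax y = runMax y N :=
    le_antisymm (ciSup_le hle) (le_ciSup ⟨_, Set.forall_mem_range.2 hle⟩ N)
  filter_upwards [eventually_ge_atTop N] with n hn
  rw [hsup, hconst n hn]

theorem eventually_backward_lindleyStep_eq {y : ℕ → ℤ}
    (hy : Tendsto (fun n => ∑ k ∈ Finset.range n, y k) atTop atTop) (w : ℕ) :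
    ∀ᶠ n in atTop, backward (fun k w => lindleyStep w (y k)) n w = supMax y := by
  rw [← map_add_atTop_eq_nat 1, eventually_map]
  filter_upwards [eventually_runMax_eq hy,
    (hy.comp (tendsto_add_atTop_nat 1)).eventually_ge_atTop (w : ℤ)] with n h1 h2
  have h3 := backward_lindleyStep_succ y n w
  simp only [Function.comp] at h2
  omega

theorem eventually_backward_real_eq {y : ℕ → ℤ}
    (hy : Tendsto (fun n => ∑ k ∈ Finset.range n, y k) atTop atTop) (x : ℝ) :
    ∀ᶠ n in atTop, backward (fun k x => max (x - (y k : ℝ)) 0) n x = supMax y := by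
  rw [← map_add_atTop_eq_nat 1, eventually_map]
  filter_upwards [eventually_runMax_eq hy,
    (hy.comp (tendsto_add_atTop_nat 1)).eventually_ge_atTop ⌈x⌉] with n h1 h2
  rw [backward_real_succ, h1, max_eq_left]
  have h3 : x ≤ ((∑ k ∈ Finset.range (n + 1), y k : ℤ) : ℝ) :=
    (Int.le_ceil x).trans (Int.cast_le.2 h2)
  exact (sub_nonpos.2 h3).trans (Nat.cast_nonneg _)

theorem measurable_lindleyStep : Measurable (Function.uncurry lindleyStep) :=
  measurable_of_countable _

theorem measurable_multiLindleyStep (d : ℕ) :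
    Measurable (Function.uncurry (multiLindleyStep (d := d))) :=
  measurable_of_countable _

variable {Ω : Type*} [MeasurableSpace Ω] {P : Measure Ω}

/-- An essential class of the Lindley process contains `0`. -/
theorem zero_mem_of_isEssentialClass {Z : ℕ → Ω → ℤ} (hpos : 0 < P {ω | 0 < Z 0 ω}) {C : Set ℕ}
    (hC : IsEssentialClass P (fun w n ω => lindley (fun k => Z k ω) w n) C) : 0 ∈ C := by
  classical
  -- From a nonzero least element a positive increment would move the chain strictly below it, while
  -- absorption keeps the chain in the class.
  have hmin := @Nat.find_min _ _ hC.nonempty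
  have hmem := Nat.find_spec hC.nonempty
  set w := Nat.find hC.nonempty with hw
  by_contra h0
  have hw0 : w ≠ 0 := fun h => h0 (h ▸ hmem)
  have hfr : ∃ᵐ ω ∂P, 0 < Z 0 ω := frequently_ae_iff.2 hpos.ne'
  obtain ⟨ω, h1, h2⟩ := (hfr.and_eventually (hC.absorbing w hmem 1)).exists
  refine hmin (m := lindley (fun k => Z k ω) w 1) ?_ h2
  simp only [lindley]
  omega

/-- If the Lindley process is positive recurrent, the underlying random walk tends to infinity. -/
theorem walk_tendsto_of_positiveRecurrent [IsProbabilityMeasure P] {Z : ℕ → Ω → ℤ}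
    (hm : ∀ n, Measurable (Z n)) (hi : iIndepFun Z P) (hd : ∀ n, IdentDistrib (Z n) (Z 0) P P)
    (hpos : 0 < P {ω | 0 < Z 0 ω}) {C : Set ℕ}
    (hC : IsPositiveRecurrentIn P (fun w n ω => lindley (fun k => Z k ω) w n) C) :
    ∀ᵐ ω ∂P, Tendsto (fun n => ∑ k ∈ Finset.range n, Z k ω) atTop atTop := by
  have hZ : Measurable (fun ω (k : ℕ) => Z k ω) := measurable_pi_lambda _ hm
  have h0 := hC.2 0 (zero_mem_of_isEssentialClass hpos hC.1)
  simp_rw [lindley_eq_trajectory] at h0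
  have hnot := not_tendsto_zero_of_positiveRecurrent measurable_lindleyStep hm hi hd 0 h0
  refine walk_tendsto_atTop hm hi hd hpos fun hzero => hnot ?_
  -- After reversal, the return to `0` at time `n` becomes nonnegativity of the partial sums up to
  -- `n`; these events decrease to nonnegativity for all time.
  simp_rw [measure_trajectory_eq_backward measurable_lindleyStep hm hi hd,
    backward_lindleyStep_zero]
  rw [← hzero]
  have hset : {ω | ∀ n, 0 ≤ ∑ k ∈ Finset.range n, Z k ω}
      = ⋂ n, {ω | runMax (fun k => Z k ω) n = 0} := by
    ext ω
    simp only [Set.mem_iInter, Set.mem_ofPred_eq, runMax_eq_zero_iff]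
    exact ⟨fun h n m _ => h m, fun h n => h n n le_rfl⟩
  rw [hset]
  refine tendsto_measure_iInter_atTop (fun n => ?_) (fun a b hab ω hω => ?_) ⟨0, measure_ne_top _ _⟩
  · exact (((measurable_runMax n).comp hZ) (measurableSet_singleton 0)).nullMeasurableSet
  · exact Nat.le_zero.1 ((monotone_runMax _ hab).trans (le_of_eq hω))

end LindleyProcess

theorem theorem4 {Ω : Type*} [MeasurableSpace Ω] (P : Measure Ω) [IsProbabilityMeasure P]
    (d : ℕ) (Y : ℕ → Ω → Fin d → ℤ)
    (hmeas : ∀ n, Measurable (Y n))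
    (hindep : iIndepFun Y P)
    (hident : ∀ n, IdentDistrib (Y n) (Y 0) P P)
    (hpos : ∀ i : Fin d, 0 < P {ω | 0 < Y 0 ω i})
    (hrec : ∀ i : Fin d, ∃ C : Set ℕ, IsPositiveRecurrentIn P (coordLindley Y i) C) :
    (∃ U : Ω → Fin d → ℕ, Measurable U ∧
      (∀ x : Fin d → ℝ, ∀ᵐ ω ∂P,
        Tendsto (fun n => backward (fun k => lindleyMap (Y k ω)) n x) atTop
          (𝓝 (fun i => (U ω i : ℝ)))) ∧
      IsProbabilityMeasure (P.map U) ∧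
      (lindleyKernel P Y).Invariant (P.map U) ∧
      (∀ ν : Measure (Fin d → ℕ), IsProbabilityMeasure ν →
        (lindleyKernel P Y).Invariant ν → ν = P.map U)) ∧
    (∃ C : Set (Fin d → ℕ), IsPositiveRecurrentIn P (multiLindley Y) C ∧
      ∀ C' : Set (Fin d → ℕ), IsEssentialClass P (multiLindley Y) C' → C' = C) := by
  have hwalk : ∀ᵐ ω ∂P, ∀ i,
      Tendsto (fun n => ∑ k ∈ Finset.range n, Y k ω i) atTop atTop := by
    refine ae_all_iff.2 fun i => ?_
    obtain ⟨C, hC⟩ := hrec i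
    have hproj : Measurable (fun v : Fin d → ℤ => v i) := measurable_pi_apply i
    exact walk_tendsto_of_positiveRecurrent (Z := fun n ω => Y n ω i)
      (fun n => hproj.comp (hmeas n)) (hindep.comp (fun _ v => v i) fun _ => hproj)
      (fun n => (hident n).comp hproj) (hpos i) hC
  let V : (ℕ → Fin d → ℤ) → Fin d → ℕ := fun y i => supMax fun k => y k i
  have hV : Measurable V := measurable_pi_lambda _ fun i => measurable_supMax.comp
    (measurable_pi_lambda _ fun k => (measurable_pi_apply i).comp (measurable_pi_apply k))
  have hY : Measurable (fun ω (k : ℕ) => Y k ω) := measurable_pi_lambda _ hmeas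
  -- The exceptional null set is that of the walks and does not depend on `x`; finitely many
  -- coordinates then stabilize simultaneously.
  have hlim : ∀ᵐ ω ∂P, ∀ x, ∀ᶠ n in atTop,
      backward (fun k x => multiLindleyStep x (Y k ω)) n x = V (fun k => Y k ω) := by
    filter_upwards [hwalk] with ω hω x
    filter_upwards [eventually_all.2 fun i => eventually_backward_lindleyStep_eq (hω i) (x i)]
      with n hn
    funext i
    exact (backward_apply (fun k i w => lindleyStep w (Y k ω i)) n x i).trans (hn i)
  have hG := measurable_multiLindleyStep d
  have hκ : ∀ w, lindleyKernel P Y w = P.map (fun ω => multiLindleyStep w (Y 0 ω)) :=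
    fun w => rfl
  refine ⟨⟨fun ω => V fun k => Y k ω, hV.comp hY, fun x => ?_,
    Measure.isProbabilityMeasure_map (hV.comp hY).aemeasurable,
    invariant_map_backwardLimit hG hmeas hindep hident hV hlim hκ, fun ν _ hinv =>
    eq_map_backwardLimit_of_invariant hG hmeas hindep hident hV hlim hκ hinv⟩, ?_⟩
  · filter_upwards [hwalk] with ω hω
    refine tendsto_const_nhds.congr' ?_
    filter_upwards [eventually_all.2 fun i => eventually_backward_real_eq (hω i) (x i)] with n hn
    funext i
    exact ((backward_apply (fun k i (x : ℝ) => max (x - (Y k ω i : ℝ)) 0) n x i).trans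
      (hn i)).symm
  · rw [multiLindley_eq_trajectory]
    exact exists_unique_essentialClass hG hmeas hindep hident hV hlim
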